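/- **Setting.** Let $\mathcal H,\mathcal V$ be real Hilbert spaces with $\mathcal V$ densely and continuously embedded into $\mathcal H$, so that $\mathcal V\hookrightarrow\mathcal H=\mathcal H'\hookrightarrow\mathcal V'$, and let $\langle\cdot,\cdot\rangle$ be the duality pairing between $\mathcal V'$ and $\mathcal V$. Let $J\ge 1$ and, for $j=1,\dots,J$, let $X_j$ be a non-empty metric space with a finite measure $\mu_j$ on a $\sigma$-algebra containing the open sets. Let $U=\prod_{j=1}^J U_j$ with $U_j$ a closed subspace of $L^2(X_j,\mu_j)^{N_j}$, and let $I_U:\mathcal V\to U$ be a bounded linear map, with components $(I_Uu)_j$. Let $A_1:\mathcal V\to\mathcal V'$ be bounded and linear with $\langle A_1u,u\rangle=0$ for all $u\in\mathcal V$. Let $\alpha_j\in C([0,\infty)\times X_j;(0,\infty))$ be such that for every $\tau>0$ there is $\kappa>0$ with $|\alpha_j(t,x)-\alpha_j(s,x)|\le\kappa|t-s|$ for all $s,t\in[0,\tau]$, $x\in X_j$. Let $g_j:\mathbb R^{N_j}\to\mathbb R^{N_j}$ be continuous with $g_j(0)=0$, $(g_j(x)-g_j(y))\cdot(x-y)\ge0$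 and $|g_j(x)|\le M(1+|x|)$ for all $x,y$, where $M>0$. Put $$\langle B(t)u,v\rangle=\sum_{j=1}^J\int_{X_j}\alpha_j(t,x_j)\,g_j((I_Uu)_j(x_j))\cdot(I_Uv)_j(x_j)\,d\mu_j(x_j),\qquad u,v\in\mathcal V,$$ $D(\mathcal A_B(t))=\{v\in\mathcal V:(A_1+B(t))v\in\mathcal H\}$ and $\mathcal A_B(t)v=(A_1+B(t))v$. A *solution* is a function $x\in C([0,\infty);\mathcal H)$ with $x(t)\in D(\mathcal A_B(t))$ for all $t\ge0$ such that, for all $t\geq 0$ outside a countable set, the strong derivative $x'(t)=-\mathcal A_B(t)x(t)$ exists in $\mathcal H$ and $s\mapsto\mathcal A_B(s)x(s)$ is continuous at $t$. Its energy is $\mathcal E(t)=\frac12\|x(t)\|_{\mathcal H}^2$. Viewing $I_U$ also as the operator $\mathcal V\to\mathcal V'$ given by $\langle I_Uu,v\rangle=(I_Uu,I_Uv)_U$, the operators $\pm A_1-I_U$ in $\mathcal H$ have domains $\{v\in\mathcal V:(\pm A_1-I_U)v\in\mathcal H\}$. **Hypotheses.** 1. $A_1-I_U$ generates a $C_0$-semigroup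 of contractions in $\mathcal H$, and $-A_1-I_U$ generates a $C_0$-semigroup of contractions $S(t)$ in $\mathcal H$ with $\|S(t)x_0\|_{\mathcal H}\le Ce^{-\omega t}\|x_0\|_{\mathcal H}$ for all $t\ge0$, $x_0\in\mathcal H$, where $C,\omega>0$. 2. For every $j$: $g_j(x)\cdot x\ge m|x|^2$ for $|x|\ge1$, and $|x|^2+|g_j(x)|^2\le G(g_j(x)\cdot x)$ for $|x|\le1$, where $m>0$ and $G:[0,\infty)\to[0,\infty)$ is concave, strictly increasing, continuous at $0$, with $G(0)=0$. 3. For all $j$ and $x_j\in X_j$ the function $\alpha_j(\cdot,x_j)$ is non-increasing; $\tilde\alpha:=\max_j\sup_{x_j\in X_j}\alpha_j(0,x_j)<\infty$; and $\alpha(t):=\min_j\inf_{x_j\in X_j}\alpha_j(t,x_j)>0$ for all $t\ge0$. **Theorem.** For all $C,\omega>0$ there is $T_0>0$, depending only on $C$ and $\omega$, such that for every $T\ge T_0$ there is a constant $c>0$, depending only on $T,C,\omega,J,\max_j\mu_j(X_j),\tilde\alpha,M$ and $m$, with the following property for every system satisfying the above. Put $\mu=\min_j\mu_j(X_j)$ and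 $h(s)=c\,(s+G(s))$ for $s\ge0$. Then $h$ is a bijection of $[0,\infty)$ onto itself, and for every solution $x$: * if $\mathcal E(0)=0$, then $\mathcal E(t)=0$ for all $t\ge0$; * if $\mathcal E(0)>0$, then $1/h^{-1}$ is integrable between $r$ and $\mathcal E(0)$ for every $r>0$, the function $\psi(r)=\int_r^{\mathcal E(0)}\frac{ds}{h^{-1}(s)}$ is a bijection of $(0,\infty)$ onto $\mathbb R$, $\alpha$ is integrable on $[T,t]$ for every $t\ge T$, and $$\mathcal E(t)\le\psi^{-1}\Big(T\mu\int_T^t\alpha(s)\,ds\Big)\qquad\text{for all }t\ge T.$$ -/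

import Mathlib

open Set Filter Topology MeasureTheory
open scoped RealInnerProductSpace

universe u v w

noncomputable section

/-- The standing data and assumptions of the abstract hyperbolic setting.

`𝓥` is densely and continuously embedded into `𝓗` through `ι`; `U = ∏ⱼ Uⱼ` (Hilbert product) is the
control space, `Uⱼ` being a closed subspace of `L²(Xⱼ, μⱼ)^{Nⱼ}`; `IU : 𝓥 → U` is the canonical
bounded linear map (only its boundedness is required, not its injectivity); `A₁ : 𝓥 → 𝓥'` is bounded,
linear and satisfies `⟨A₁ u, u⟩ = 0`. The coefficients `αⱼ(t, x)` are only relevant for `t ≥ 0`.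
The linear growth of the `gⱼ` is not part of this structure, since its constant has to be named. -/
structure HyperbolicSystem (J : ℕ) (N : Fin J → ℕ)
    (X : Fin J → Type u) [∀ j, MetricSpace (X j)] [∀ j, MeasurableSpace (X j)]
    [∀ j, OpensMeasurableSpace (X j)]
    (𝓗 : Type v) [NormedAddCommGroup 𝓗] [InnerProductSpace ℝ 𝓗]
    (𝓥 : Type w) [NormedAddCommGroup 𝓥] [InnerProductSpace ℝ 𝓥] where
  ι : 𝓥 →L[ℝ] 𝓗
  ι_injective : Function.Injective ι
  ι_denseRange : DenseRange ι
  μ : ∀ j, Measure (X j)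
  μ_finite : ∀ j, IsFiniteMeasure (μ j)
  U : ∀ j, Submodule ℝ (Lp (EuclideanSpace ℝ (Fin (N j))) 2 (μ j))
  U_closed : ∀ j, IsClosed (U j : Set (Lp (EuclideanSpace ℝ (Fin (N j))) 2 (μ j)))
  IU : 𝓥 →L[ℝ] PiLp 2 (fun j => U j)
  A₁ : 𝓥 →L[ℝ] StrongDual ℝ 𝓥
  A₁_skew : ∀ u, A₁ u u = 0
  α : ∀ j, ℝ → X j → ℝ
  α_continuous : ∀ j, ContinuousOn (fun q : ℝ × X j => α j q.1 q.2) (Ici 0 ×ˢ univ)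
  α_pos : ∀ j, ∀ t ≥ 0, ∀ x, 0 < α j t x
  α_lipschitz : ∀ j, ∀ T > 0, ∃ κ > 0, ∀ s ∈ Icc (0 : ℝ) T, ∀ t ∈ Icc (0 : ℝ) T, ∀ x,
    |α j t x - α j s x| ≤ κ * |t - s|
  g : ∀ j, EuclideanSpace ℝ (Fin (N j)) → EuclideanSpace ℝ (Fin (N j))
  g_continuous : ∀ j, Continuous (g j)
  g_monotone : ∀ j x y, 0 ≤ ⟪g j x - g j y, x - y⟫
  g_zero : ∀ j, g j 0 = 0

/-- Strongly continuous semigroups of linear contractions `(S t)_{t ≥ 0}` on `𝓗`. -/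
structure IsContractionSemigroup {𝓗 : Type v} [NormedAddCommGroup 𝓗] [InnerProductSpace ℝ 𝓗]
    (S : ℝ → 𝓗 →L[ℝ] 𝓗) : Prop where
  zero : S 0 = ContinuousLinearMap.id ℝ 𝓗
  add : ∀ s ≥ 0, ∀ t ≥ 0, S (s + t) = (S s).comp (S t)
  continuousOn : ∀ x, ContinuousOn (fun t => S t x) (Ici 0)
  contraction : ∀ t ≥ 0, ∀ x, ‖S t x‖ ≤ ‖x‖

/-- The operator in `𝓗` with graph `R` is the infinitesimal generator of the semigroup `S`
(same domain and same values). -/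
def IsGeneratorGraph {𝓗 : Type v} [NormedAddCommGroup 𝓗] [InnerProductSpace ℝ 𝓗]
    (S : ℝ → 𝓗 →L[ℝ] 𝓗) (R : 𝓗 → 𝓗 → Prop) : Prop :=
  ∀ x y, R x y ↔ Tendsto (fun s : ℝ => s⁻¹ • (S s x - x)) (𝓝[>] 0) (𝓝 y)

namespace HyperbolicSystem

variable {J : ℕ} {N : Fin J → ℕ}
  {X : Fin J → Type u} [∀ j, MetricSpace (X j)] [∀ j, MeasurableSpace (X j)]
  [∀ j, OpensMeasurableSpace (X j)]
  {𝓗 : Type v} [NormedAddCommGroup 𝓗] [InnerProductSpace ℝ 𝓗]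
  {𝓥 : Type w} [NormedAddCommGroup 𝓥] [InnerProductSpace ℝ 𝓥]

/-- The component `(I_U u)_j`, an `ℝ^{N j}`-valued square integrable function on `X j`. -/
def comp (Y : HyperbolicSystem J N X 𝓗 𝓥) (u : 𝓥) (j : Fin J) :
    Lp (EuclideanSpace ℝ (Fin (N j))) 2 (Y.μ j) :=
  (Y.IU u j : Lp (EuclideanSpace ℝ (Fin (N j))) 2 (Y.μ j))

/-- The nonlinear, time-dependent feedback `⟨B(t) u, v⟩`. -/
def B (Y : HyperbolicSystem J N X 𝓗 𝓥) (t : ℝ) (u v : 𝓥) : ℝ :=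
  ∑ j, ∫ x, Y.α j t x * ⟪Y.g j (Y.comp u j x), Y.comp v j x⟫ ∂(Y.μ j)

/-- The graph of the realization in `𝓗` of an operator `L : 𝓥 → 𝓥'`, where `𝓗` is identified with a
subspace of `𝓥'`: `x` comes from some `u ∈ 𝓥` with `L u ∈ 𝓗`, and `L u = y`. -/
def realization (Y : HyperbolicSystem J N X 𝓗 𝓥) (L : 𝓥 → 𝓥 → ℝ) (x y : 𝓗) : Prop :=
  ∃ u, Y.ι u = x ∧ ∀ v, L u v = ⟪y, Y.ι v⟫

/-- The graph of the operator `𝓐_B(t)`, the realization of `A₁ + B(t)` in `𝓗`. -/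
def graphAB (Y : HyperbolicSystem J N X 𝓗 𝓥) (t : ℝ) : 𝓗 → 𝓗 → Prop :=
  Y.realization fun u v => Y.A₁ u v + Y.B t u v

/-- The graph of `A₁ - I_U`, where `I_U` stands for `⟨I_U u, v⟩ = (I_U u, I_U v)_U`. -/
def graphForward (Y : HyperbolicSystem J N X 𝓗 𝓥) : 𝓗 → 𝓗 → Prop :=
  Y.realization fun u v => Y.A₁ u v - ⟪Y.IU u, Y.IU v⟫

/-- The graph of `-A₁ - I_U`. -/
def graphBackward (Y : HyperbolicSystem J N X 𝓗 𝓥) : 𝓗 → 𝓗 → Prop :=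
  Y.realization fun u v => -Y.A₁ u v - ⟪Y.IU u, Y.IU v⟫

/-- `A₁ - I_U` generates a contraction semigroup in `𝓗`, and `-A₁ - I_U` generates a contraction
semigroup in `𝓗` that is exponentially stable with constants `C` and `ω`. -/
def ExpStable (Y : HyperbolicSystem J N X 𝓗 𝓥) (C ω : ℝ) : Prop :=
  (∃ S : ℝ → 𝓗 →L[ℝ] 𝓗, IsContractionSemigroup S ∧ IsGeneratorGraph S Y.graphForward) ∧
  (∃ S : ℝ → 𝓗 →L[ℝ] 𝓗, IsContractionSemigroup S ∧ IsGeneratorGraph S Y.graphBackward ∧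
    ∀ t ≥ 0, ∀ x, ‖S t x‖ ≤ C * Real.exp (-ω * t) * ‖x‖)

/-- `x` is a solution of `x' + A₁ x + B(t) x = 0` on `[0, ∞)`: `x ∈ C([0, ∞), 𝓗)`,
`x(t) ∈ D(𝓐_B(t))` for all `t ≥ 0`, and, except at countably many `t`, the strong derivative
`x'(t) = -𝓐_B(t) x(t)` exists in `𝓗` and `t ↦ 𝓐_B(t) x(t)` is continuous. -/
def IsSolution (Y : HyperbolicSystem J N X 𝓗 𝓥) (x : ℝ → 𝓗) : Prop :=
  ContinuousOn x (Ici 0) ∧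
  ∃ y : ℝ → 𝓗, (∀ t ≥ 0, Y.graphAB t (x t) (y t)) ∧
    ∃ Z : Set ℝ, Z.Countable ∧ ∀ t ≥ 0, t ∉ Z →
      HasDerivWithinAt x (-y t) (Ici 0) t ∧ ContinuousWithinAt y (Ici 0) t

/-- `max_j μ_j(X_j)` -/
def maxMass (Y : HyperbolicSystem J N X 𝓗 𝓥) : ℝ := ⨆ j, (Y.μ j).real univ

/-- `min_j μ_j(X_j)` -/
def minMass (Y : HyperbolicSystem J N X 𝓗 𝓥) : ℝ := ⨅ j, (Y.μ j).real univ

/-- `max_j sup_{x ∈ X_j} α_j(0, x)` -/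
def alphaSup (Y : HyperbolicSystem J N X 𝓗 𝓥) : ℝ := ⨆ j, ⨆ x, Y.α j 0 x

/-- `α(t) = min_j inf_{x ∈ X_j} α_j(t, x)` -/
def alphaInf (Y : HyperbolicSystem J N X 𝓗 𝓥) (t : ℝ) : ℝ := ⨅ j, ⨅ x, Y.α j t x

end HyperbolicSystem

/-- The energy `𝓔(t) = ½ ‖x(t)‖²`. -/
def energy {𝓗 : Type v} [NormedAddCommGroup 𝓗] (x : ℝ → 𝓗) (t : ℝ) : ℝ := ‖x t‖ ^ 2 / 2

/-- `h(x) = c (x + G(x))`, considered on `[0, ∞)`. -/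
def hFun (c : ℝ) (G : ℝ → ℝ) (x : ℝ) : ℝ := c * (x + G x)

/-- `p = h⁻¹`, the inverse of `h : [0, ∞) → [0, ∞)`. -/
def pFun (c : ℝ) (G : ℝ → ℝ) : ℝ → ℝ := Function.invFunOn (hFun c G) (Ici 0)

/-- `ψ(x) = ∫_x^{E₀} ds / p(s)`, considered on `(0, ∞)`. -/
def psiFun (c : ℝ) (G : ℝ → ℝ) (E₀ x : ℝ) : ℝ := ∫ s in x..E₀, 1 / pFun c G s

/-- `ψ⁻¹`, the inverse of `ψ : (0, ∞) → ℝ`. -/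
def psiInv (c : ℝ) (G : ℝ → ℝ) (E₀ : ℝ) : ℝ → ℝ := Function.invFunOn (psiFun c G E₀) (Ioi 0)

end

/-! On a window `[a, a + T]` the solution is compared with the orbit of the stable linear semigroup
starting at the same point. `A₁` is skew, so it drops out of the derivative of the squared distance,
and only the feedback and `I_U` remain. Completing squares bounds that remainder pointwise by `|ξ|²
+ α²|g(ξ)|²`, where `ξ` is the observation of the solution; the linear orbit no longer appears.

The growth hypotheses and the concavity of `G` bound this, for any `q > 0`, by an affine function of
the dissipation density `g(ξ) · ξ` with coefficients governed by `G q / q` and `G q`. This is a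
tangent-type substitute for Jensen's inequality. The dissipation integrates to the energy drop `Δ`
over the window. Since the semigroup has norm at most `1/2` at time `T`, the initial energy of the
window is bounded in terms of `Δ` and `q` (`feedback_le`, `norm_sub_orbit_sq_le`, `energy_le`).

Letting `q` decrease to `Δ / (T² μ α(a + T))` gives `T² μ α(a + T) h⁻¹(E(a)) ≤ Δ` (`step_le`). This
is a discrete form of `E' ≤ -Tμα h⁻¹(E)`; summing it through `ψ` over consecutive windows gives the
decay rate (`le_psiInv_of_step`). -/

/-! ### Monotonicity from right derivatives off a countable set. -/

/-- If `f a < f b`, some intermediate level avoids the countable set `f '' Z`. At the last time `f`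
is at or below that level, the right derivative exists, yet `f` is larger immediately afterwards, so
it cannot be negative. -/
theorem le_of_rightDeriv_neg_off_countable {f f' : ℝ → ℝ} {a b : ℝ} {Z : Set ℝ}
    (hab : a ≤ b) (hf : ContinuousOn f (Icc a b)) (hZ : Z.Countable)
    (hd : ∀ t ∈ Ico a b, t ∉ Z → HasDerivWithinAt f (f' t) (Ici t) t)
    (hf' : ∀ t ∈ Ico a b, t ∉ Z → f' t < 0) : f b ≤ f a := by
  by_contra! hlt
  obtain ⟨c, hc, hcZ⟩ : ∃ c ∈ Ioo (f a) (f b), c ∉ f '' Z := by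
    by_contra! h
    exact (Cardinal.Real.Ioo_countable_iff.not.mpr (not_le.mpr hlt))
      ((hZ.image f).mono fun c hc => h c hc)
  let K : Set ℝ := Icc a b ∩ f ⁻¹' Iic c
  have hK : IsCompact K :=
    isCompact_Icc.of_isClosed_subset (hf.preimage_isClosed_of_isClosed isClosed_Icc isClosed_Iic)
      inter_subset_left
  obtain ⟨s, hs⟩ := hK.exists_isGreatest ⟨a, ⟨le_rfl, hab⟩, hc.1.le⟩
  have hsb : s < b := lt_of_le_of_ne hs.1.1.2 fun h => by
    have := hs.1.2; rw [h] at this; exact absurd this (not_le.mpr hc.2)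
  have hgt : ∀ t, s < t → t ≤ b → c < f t := fun t h1 h2 => by
    by_contra! h
    exact absurd (hs.2 ⟨⟨hs.1.1.1.trans h1.le, h2⟩, h⟩) (not_le.mpr h1)
  have hmem : Ioc s b ∈ 𝓝[>] s := Ioc_mem_nhdsGT hsb
  have hfs : f s = c := by
    refine le_antisymm hs.1.2 ?_
    have ht : Tendsto f (𝓝[>] s) (𝓝 (f s)) :=
      (hf s hs.1.1).mono_left (nhdsWithin_le_of_mem (by
        filter_upwards [hmem] with t ht using ⟨hs.1.1.1.trans ht.1.le, ht.2⟩))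
    exact ge_of_tendsto ht (by filter_upwards [hmem] with t ht using (hgt t ht.1 ht.2).le)
  have hsZ : s ∉ Z := fun h => hcZ ⟨s, h, hfs⟩
  have hsI : s ∈ Ico a b := ⟨hs.1.1.1, hsb⟩
  have h1 := (hasDerivWithinAt_iff_tendsto_slope' (by simp)).1 (hd s hsI hsZ).Ioi_of_Ici
  have h2 := (h1.eventually_lt_const (hf' s hsI hsZ)).and hmem
  obtain ⟨t, ht, hts⟩ := h2.exists
  rw [slope_def_field, div_neg_iff] at ht
  have := hgt t hts.1 hts.2
  have := hts.1
  rcases ht with h | h <;> linarith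

theorem le_of_rightDeriv_nonpos_off_countable {f f' : ℝ → ℝ} {a b : ℝ} {Z : Set ℝ}
    (hab : a ≤ b) (hf : ContinuousOn f (Icc a b)) (hZ : Z.Countable)
    (hd : ∀ t ∈ Ico a b, t ∉ Z → HasDerivWithinAt f (f' t) (Ici t) t)
    (hf' : ∀ t ∈ Ico a b, t ∉ Z → f' t ≤ 0) : f b ≤ f a := by
  -- Subtracting `ε * t` makes the derivative strictly negative.
  have key : ∀ ε > 0, f b ≤ f a + ε * (b - a) := fun ε hε => by
    have := le_of_rightDeriv_neg_off_countable (f := fun t => f t - ε * t)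
      (f' := fun t => f' t - ε * 1) hab (hf.sub (by fun_prop)) hZ
      (fun t ht htZ => (hd t ht htZ).sub ((hasDerivWithinAt_id t _).const_mul ε))
      (fun t ht htZ => by have := hf' t ht htZ; linarith)
    linarith
  have ht : Tendsto (fun ε => f a + ε * (b - a)) (𝓝[>] 0) (𝓝 (f a + 0 * (b - a))) :=
    tendsto_nhdsWithin_of_tendsto_nhds (Continuous.tendsto (by fun_prop) 0)
  rw [zero_mul, add_zero] at ht
  exact ge_of_tendsto ht (by filter_upwards [self_mem_nhdsWithin] with ε hε using key ε hε)

/-! ### Orbits and generator domain of a contraction semigroup. -/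

namespace IsContractionSemigroup

variable {𝓗 : Type v} [NormedAddCommGroup 𝓗] [InnerProductSpace ℝ 𝓗] {S : ℝ → 𝓗 →L[ℝ] 𝓗}

theorem add_apply (hS : IsContractionSemigroup S) {s t : ℝ} (hs : 0 ≤ s) (ht : 0 ≤ t) (x : 𝓗) :
    S (s + t) x = S s (S t x) := by
  rw [hS.add s hs t ht]; rfl

theorem tendsto_orbit (hS : IsContractionSemigroup S) {z z' : 𝓗}
    (h : Tendsto (fun s : ℝ => s⁻¹ • (S s z - z)) (𝓝[>] 0) (𝓝 z')) {r : ℝ} (hr : 0 ≤ r) :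
    Tendsto (fun s : ℝ => s⁻¹ • (S s (S r z) - S r z)) (𝓝[>] 0) (𝓝 (S r z')) := by
  refine (((S r).continuous.tendsto z').comp h).congr' ?_
  filter_upwards [self_mem_nhdsWithin] with s hs
  have hs : 0 ≤ s := le_of_lt hs
  simp only [Function.comp, map_smul, map_sub]
  rw [← hS.add_apply hr hs, ← hS.add_apply hs hr, add_comm]

theorem hasDerivWithinAt_orbit (hS : IsContractionSemigroup S) {z z' : 𝓗}
    (h : Tendsto (fun s : ℝ => s⁻¹ • (S s z - z)) (𝓝[>] 0) (𝓝 z')) {a r : ℝ} (hr : a ≤ r) :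
    HasDerivWithinAt (fun s => S (s - a) z) (S (r - a) z') (Ici r) r := by
  rw [← hasDerivWithinAt_Ioi_iff_Ici, hasDerivWithinAt_iff_tendsto_slope' (by simp)]
  have h1 : Tendsto (fun s => s - r) (𝓝[>] r) (𝓝[>] 0) := by
    refine tendsto_nhdsWithin_iff.2 ⟨?_, ?_⟩
    · refine tendsto_nhdsWithin_of_tendsto_nhds ?_
      have : Continuous fun s : ℝ => s - r := by fun_prop
      simpa using this.tendsto r
    · filter_upwards [self_mem_nhdsWithin] with s hs
      exact sub_pos.2 (show r < s from hs)
  refine ((hS.tendsto_orbit h (sub_nonneg.2 hr)).comp h1).congr' ?_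
  filter_upwards [self_mem_nhdsWithin] with s hs
  have hs : r < s := hs
  simp only [Function.comp, slope, vsub_eq_sub]
  rw [← hS.add_apply (sub_nonneg.2 hs.le) (sub_nonneg.2 hr), sub_add_sub_cancel]

/-- Density of the generator's domain: the averages of the orbit of `x` over `[0, h]` lie in the
domain and tend to `x` as `h` tends to zero. -/
theorem exists_tendsto_norm_sub_lt [CompleteSpace 𝓗] (hS : IsContractionSemigroup S) (x : 𝓗)
    {ε : ℝ} (hε : 0 < ε) :
    ∃ z z', Tendsto (fun s : ℝ => s⁻¹ • (S s z - z)) (𝓝[>] 0) (𝓝 z') ∧ ‖z - x‖ < ε := by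
  -- Truncation makes the orbit continuous on the whole line; nothing is known about `S` at negative
  -- times.
  let f : ℝ → 𝓗 := fun s => S (max s 0) x
  have hf : Continuous f :=
    (hS.continuousOn x).comp_continuous (by fun_prop) fun s => le_max_right s 0
  let F : ℝ → 𝓗 := fun r => ∫ s in (0 : ℝ)..r, f s
  have hF : ∀ r, HasDerivAt F (f r) r := fun r =>
    intervalIntegral.integral_hasDerivAt_right (hf.intervalIntegrable _ _)
      (hf.stronglyMeasurableAtFilter _ _) hf.continuousAt
  have hF0 : F 0 = 0 := intervalIntegral.integral_same
  have hf0 : f 0 = x := by simp [f, hS.zero]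
  have hlim : ∀ h, Tendsto (fun r : ℝ => r⁻¹ • (F (h + r) - F h)) (𝓝[>] 0) (𝓝 (f h)) := fun h =>
    (hF h).tendsto_slope_zero_right
  have hSF : ∀ r ≥ 0, ∀ h ≥ 0, S r (F h) = F (h + r) - F r := fun r hr h hh => by
    have e1 : S r (F h) = ∫ s in (0 : ℝ)..h, S r (f s) :=
      ((S r).intervalIntegral_comp_comm (hf.intervalIntegrable _ _)).symm
    have e2 : (∫ s in (0 : ℝ)..h, S r (f s)) = ∫ s in (0 : ℝ)..h, f (s + r) := by
      refine intervalIntegral.integral_congr fun s hs => ?_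
      rw [uIcc_of_le hh] at hs
      simp only [f]
      rw [max_eq_left hs.1, max_eq_left (add_nonneg hs.1 hr), add_comm s r,
        hS.add_apply hr hs.1]
    rw [e1, e2, intervalIntegral.integral_comp_add_right, zero_add]
    exact (intervalIntegral.integral_interval_sub_left (hf.intervalIntegrable _ _)
      (hf.intervalIntegrable _ _)).symm
  have h0 : Tendsto (fun r : ℝ => r⁻¹ • F r) (𝓝[>] 0) (𝓝 x) := by
    simpa [hF0, hf0] using hlim 0
  obtain ⟨h, hh, hpos⟩ :=
    ((h0.eventually (Metric.ball_mem_nhds x hε)).and self_mem_nhdsWithin).exists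
  have hpos : 0 < h := hpos
  refine ⟨h⁻¹ • F h, h⁻¹ • (f h - x), ?_, by simpa [dist_eq_norm] using hh⟩
  refine (((hlim h).sub h0).const_smul h⁻¹).congr' ?_
  filter_upwards [self_mem_nhdsWithin] with r hr
  rw [map_smul, hSF r (le_of_lt hr) h hpos.le, ← smul_sub, ← smul_sub, smul_comm]
  congr 2
  abel

end IsContractionSemigroup

/-! ### The functions `h`, `h⁻¹`, `ψ`, and the discrete comparison argument. -/

section InverseFunctions

variable {c : ℝ} {G : ℝ → ℝ}

theorem nonneg_of_strictMonoOn_zero (hmono : StrictMonoOn G (Ici 0)) (h0 : G 0 = 0) {s : ℝ}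
    (hs : 0 ≤ s) : 0 ≤ G s := by
  simpa [h0] using hmono.monotoneOn self_mem_Ici hs hs

/-- A concave increasing function vanishing at zero lies below `G q (1 + s / q)`. -/
theorem ConcaveOn.le_add_div_mul (hconc : ConcaveOn ℝ (Ici 0) G) (hmono : StrictMonoOn G (Ici 0))
    (h0 : G 0 = 0) {q s : ℝ} (hq : 0 < q) (hs : 0 ≤ s) : G s ≤ G q + G q / q * s := by
  have hGq := nonneg_of_strictMonoOn_zero hmono h0 hq.le
  rcases le_or_gt s q with h | h
  · have := hmono.monotoneOn hs hq.le h
    have : 0 ≤ G q / q * s := by positivity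
    linarith
  · have hs' : 0 < s := hq.trans h
    -- `q` is the convex combination of `s` and `0` with weight `q / s`, so concavity gives `G s / s
    -- ≤ G q / q`.
    have := hconc.2 (show s ∈ Ici 0 from hs) self_mem_Ici
      (show 0 ≤ q / s by positivity) (sub_nonneg.2 ((div_le_one hs').2 h.le)) (by ring)
    simp only [smul_eq_mul, mul_zero, add_zero, h0] at this
    rw [div_mul_cancel₀ _ hs'.ne'] at this
    have h2 : G s ≤ G q / q * s := by
      rw [div_mul_eq_mul_div, le_div_iff₀ hq]
      rw [div_mul_eq_mul_div, div_le_iff₀ hs'] at this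
      linarith
    linarith

theorem hFun_strictMonoOn (hc : 0 < c) (hmono : StrictMonoOn G (Ici 0)) :
    StrictMonoOn (hFun c G) (Ici 0) := fun a ha b hb hab => by
  have := hmono ha hb hab
  exact mul_lt_mul_of_pos_left (by linarith) hc

theorem mul_le_hFun (hc : 0 < c) (hmono : StrictMonoOn G (Ici 0)) (h0 : G 0 = 0) {s : ℝ}
    (hs : 0 ≤ s) : c * s ≤ hFun c G s :=
  mul_le_mul_of_nonneg_left
    (le_add_of_nonneg_right (nonneg_of_strictMonoOn_zero hmono h0 hs)) hc.le

theorem hFun_zero (h0 : G 0 = 0) : hFun c G 0 = 0 := by simp [hFun, h0]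

/-- Concavity gives continuity away from zero, the hypothesis gives it at zero, and `c * s ≤ h s`
makes `h` unbounded. -/
theorem hFun_bijOn (hc : 0 < c) (hconc : ConcaveOn ℝ (Ici 0) G) (hmono : StrictMonoOn G (Ici 0))
    (h0 : G 0 = 0) (hcont : ContinuousWithinAt G (Ici 0) 0) :
    BijOn (hFun c G) (Ici 0) (Ici 0) := by
  refine ⟨fun s hs => ?_, (hFun_strictMonoOn hc hmono).injOn, fun y hy => ?_⟩
  · have hs : 0 ≤ s := hs
    exact (by positivity : 0 ≤ c * s).trans (mul_le_hFun hc hmono h0 hs)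
  · have hy : 0 ≤ y := hy
    have hG : ContinuousOn G (Ici 0) := fun s hs => by
      rcases eq_or_lt_of_le (show 0 ≤ s from hs) with rfl | hs
      · exact hcont
      · have := hconc.continuousOn_interior
        rw [interior_Ici] at this
        exact (this.continuousAt (Ioi_mem_nhds hs)).continuousWithinAt
    have hh : ContinuousOn (hFun c G) (Icc 0 (y / c)) :=
      (continuousOn_const.mul (continuousOn_id.add hG)).mono Icc_subset_Ici_self
    have hyc : 0 ≤ y / c := by positivity
    obtain ⟨s, hs, hsy⟩ := intermediate_value_Icc hyc hh
      (show y ∈ Icc _ _ from ⟨by rwa [hFun_zero h0], by simpa [mul_div_cancel₀ _ hc.ne'] using mul_le_hFun hc hmono h0 hyc⟩)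
    exact ⟨s, hs.1, hsy⟩

theorem pFun_nonneg (hbij : BijOn (hFun c G) (Ici 0) (Ici 0)) {s : ℝ} (hs : 0 ≤ s) :
    0 ≤ pFun c G s :=
  hbij.surjOn.mapsTo_invFunOn hs

theorem hFun_pFun (hbij : BijOn (hFun c G) (Ici 0) (Ici 0)) {s : ℝ} (hs : 0 ≤ s) :
    hFun c G (pFun c G s) = s :=
  hbij.surjOn.rightInvOn_invFunOn hs

theorem pFun_pos (h0 : G 0 = 0) (hbij : BijOn (hFun c G) (Ici 0) (Ici 0)) {s : ℝ} (hs : 0 < s) :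
    0 < pFun c G s := by
  refine lt_of_le_of_ne (pFun_nonneg hbij hs.le) fun h => hs.ne ?_
  rw [← hFun_pFun hbij hs.le, ← h, hFun_zero h0]

theorem pFun_le_iff (hc : 0 < c) (hmono : StrictMonoOn G (Ici 0))
    (hbij : BijOn (hFun c G) (Ici 0) (Ici 0)) {s r : ℝ} (hs : 0 ≤ s) (hr : 0 ≤ r) :
    pFun c G s ≤ r ↔ s ≤ hFun c G r := by
  rw [← (hFun_strictMonoOn hc hmono).le_iff_le (pFun_nonneg hbij hs) hr, hFun_pFun hbij hs]

theorem pFun_mono (hc : 0 < c) (hmono : StrictMonoOn G (Ici 0))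
    (hbij : BijOn (hFun c G) (Ici 0) (Ici 0)) {s r : ℝ} (hs : 0 ≤ s) (hsr : s ≤ r) :
    pFun c G s ≤ pFun c G r := by
  rwa [pFun_le_iff hc hmono hbij hs (pFun_nonneg hbij (hs.trans hsr)),
    hFun_pFun hbij (hs.trans hsr)]

theorem pFun_le_div (hc : 0 < c) (hmono : StrictMonoOn G (Ici 0)) (h0 : G 0 = 0)
    (hbij : BijOn (hFun c G) (Ici 0) (Ici 0)) {s : ℝ} (hs : 0 ≤ s) : pFun c G s ≤ s / c := by
  rw [le_div_iff₀ hc, mul_comm]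
  exact (mul_le_hFun hc hmono h0 (pFun_nonneg hbij hs)).trans_eq (hFun_pFun hbij hs)

theorem intervalIntegrable_one_div_pFun (hc : 0 < c) (hmono : StrictMonoOn G (Ici 0))
    (h0 : G 0 = 0) (hbij : BijOn (hFun c G) (Ici 0) (Ici 0)) {a b : ℝ} (ha : 0 < a) (hb : 0 < b) :
    IntervalIntegrable (fun s => 1 / pFun c G s) volume a b := by
  refine AntitoneOn.intervalIntegrable fun s hs r _ hsr => ?_
  have hs0 : 0 < s := (lt_min ha hb).trans_le hs.1
  exact one_div_le_one_div_of_le (pFun_pos h0 hbij hs0) (pFun_mono hc hmono hbij hs0.le hsr)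

theorem psiFun_sub (hc : 0 < c) (hmono : StrictMonoOn G (Ici 0))
    (h0 : G 0 = 0) (hbij : BijOn (hFun c G) (Ici 0) (Ici 0)) {E r s : ℝ} (hE : 0 < E)
    (hr : 0 < r) (hs : 0 < s) :
    psiFun c G E r - psiFun c G E s = ∫ t in r..s, 1 / pFun c G t := by
  rw [sub_eq_iff_eq_add]
  exact (intervalIntegral.integral_add_adjacent_intervals
    (intervalIntegrable_one_div_pFun hc hmono h0 hbij hr hs)
    (intervalIntegrable_one_div_pFun hc hmono h0 hbij hs hE)).symm

theorem div_pFun_le_psiFun_sub (hc : 0 < c) (hmono : StrictMonoOn G (Ici 0))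
    (h0 : G 0 = 0) (hbij : BijOn (hFun c G) (Ici 0) (Ici 0)) {E r s : ℝ} (hE : 0 < E)
    (hr : 0 < r) (hrs : r ≤ s) :
    (s - r) / pFun c G s ≤ psiFun c G E r - psiFun c G E s := by
  have hs := hr.trans_le hrs
  rw [psiFun_sub hc hmono h0 hbij hE hr hs]
  have : (∫ _ in r..s, 1 / pFun c G s) = (s - r) / pFun c G s := by
    rw [intervalIntegral.integral_const, smul_eq_mul, mul_one_div]
  rw [← this]
  refine intervalIntegral.integral_mono_on hrs (by simp)
    (intervalIntegrable_one_div_pFun hc hmono h0 hbij hr hs) fun t ht => ?_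
  have ht0 := hr.trans_le ht.1
  exact one_div_le_one_div_of_le (pFun_pos h0 hbij ht0) (pFun_mono hc hmono hbij ht0.le ht.2)

theorem psiFun_strictAntiOn (hc : 0 < c) (hmono : StrictMonoOn G (Ici 0))
    (h0 : G 0 = 0) (hbij : BijOn (hFun c G) (Ici 0) (Ici 0)) {E : ℝ} (hE : 0 < E) :
    StrictAntiOn (psiFun c G E) (Ioi 0) := fun r hr s hs hrs => by
  have h1 := div_pFun_le_psiFun_sub hc hmono h0 hbij hE hr hrs.le
  have h2 : 0 < (s - r) / pFun c G s := div_pos (sub_pos.2 hrs) (pFun_pos h0 hbij hs)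
  linarith

/-- Since `h⁻¹(t) ≤ t / c`, the integrand is at least `c / t`. This makes `ψ` unbounded in both
directions. -/
theorem log_le_psiFun_sub (hc : 0 < c) (hmono : StrictMonoOn G (Ici 0))
    (h0 : G 0 = 0) (hbij : BijOn (hFun c G) (Ici 0) (Ici 0)) {E r s : ℝ} (hE : 0 < E)
    (hr : 0 < r) (hrs : r ≤ s) :
    c * Real.log (s / r) ≤ psiFun c G E r - psiFun c G E s := by
  have hs := hr.trans_le hrs
  rw [psiFun_sub hc hmono h0 hbij hE hr hs, ← integral_one_div_of_pos hr hs,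
    ← intervalIntegral.integral_const_mul]
  refine intervalIntegral.integral_mono_on hrs ?_
    (intervalIntegrable_one_div_pFun hc hmono h0 hbij hr hs) fun t ht => ?_
  · refine (intervalIntegral.intervalIntegrable_one_div (fun t ht => ?_)
      continuousOn_id).const_mul c
    rw [uIcc_of_le hrs] at ht
    exact (hr.trans_le ht.1).ne'
  · have ht0 := hr.trans_le ht.1
    rw [mul_one_div, le_div_iff₀ (pFun_pos h0 hbij ht0)]
    have := pFun_le_div hc hmono h0 hbij ht0.le
    calc c / t * pFun c G t ≤ c / t * (t / c) := by gcongr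
      _ = 1 := by field_simp

theorem psiFun_continuousOn (hc : 0 < c) (hmono : StrictMonoOn G (Ici 0))
    (h0 : G 0 = 0) (hbij : BijOn (hFun c G) (Ici 0) (Ici 0)) {E a b : ℝ} (hE : 0 < E)
    (ha : 0 < a) (hab : a ≤ b) : ContinuousOn (psiFun c G E) (Icc a b) := by
  have h1 := intervalIntegral.continuousOn_primitive_interval'
    (intervalIntegrable_one_div_pFun hc hmono h0 hbij ha (ha.trans_le hab))
    (left_mem_uIcc (a := a) (b := b))
  rw [uIcc_of_le hab] at h1
  refine ((continuousOn_const (c := psiFun c G E a)).sub h1).congr fun r hr => ?_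
  have := psiFun_sub hc hmono h0 hbij hE ha (ha.trans_le hr.1)
  simp only [Pi.sub_apply]
  linarith

theorem psiFun_self (E : ℝ) : psiFun c G E E = 0 := intervalIntegral.integral_same

theorem psiFun_bijOn (hc : 0 < c) (hmono : StrictMonoOn G (Ici 0))
    (h0 : G 0 = 0) (hbij : BijOn (hFun c G) (Ici 0) (Ici 0)) {E : ℝ} (hE : 0 < E) :
    BijOn (psiFun c G E) (Ioi 0) univ := by
  refine ⟨mapsTo_univ _ _, (psiFun_strictAntiOn hc hmono h0 hbij hE).injOn, fun y _ => ?_⟩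
  -- Chosen so that `c * log k = |y|`: then `ψ (E / k) ≥ |y|` and `ψ (E * k) ≤ -|y|`.
  let k := Real.exp (|y| / c)
  have hk : 1 ≤ k := Real.one_le_exp (by positivity)
  have hk0 : 0 < k := by positivity
  have h1 : E / k ≤ E := div_le_self hE.le hk
  have h2 : E ≤ E * k := le_mul_of_one_le_right hE.le hk
  have hEk : 0 < E / k := by positivity
  have hlog : c * Real.log k = |y| := by
    rw [Real.log_exp, mul_div_cancel₀ _ hc.ne']
  have e1 := log_le_psiFun_sub hc hmono h0 hbij hE hEk h1
  have e2 := log_le_psiFun_sub hc hmono h0 hbij hE hE h2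
  rw [show E / (E / k) = k by field_simp, hlog, psiFun_self] at e1
  rw [show E * k / E = k by field_simp, hlog, psiFun_self] at e2
  obtain ⟨r, hr, hry⟩ := intermediate_value_Icc' (h1.trans h2)
    (psiFun_continuousOn hc hmono h0 hbij hE hEk (h1.trans h2))
    (show y ∈ Icc _ _ from ⟨by linarith [neg_abs_le y], by linarith [le_abs_self y]⟩)
  exact ⟨r, hEk.trans_le hr.1, hry⟩

/-- The hypothesis is conditional because `ψ` is meaningful only on positive arguments; for `e ≤ 0`
the bound holds since `ψ⁻¹` is positive. -/
theorem le_psiInv (hc : 0 < c) (hmono : StrictMonoOn G (Ici 0))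
    (h0 : G 0 = 0) (hbij : BijOn (hFun c G) (Ici 0) (Ici 0)) {E e y : ℝ} (hE : 0 < E)
    (h : 0 < e → y ≤ psiFun c G E e) : e ≤ psiInv c G E y := by
  have hψ := psiFun_bijOn hc hmono h0 hbij hE
  have hpos : 0 < psiInv c G E y := hψ.surjOn.mapsTo_invFunOn (mem_univ y)
  have heq : psiFun c G E (psiInv c G E y) = y := hψ.surjOn.rightInvOn_invFunOn (mem_univ y)
  by_contra! hlt
  have he := hpos.trans hlt
  have := psiFun_strictAntiOn hc hmono h0 hbij hE hpos he hlt
  linarith [h he]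

/-- The comparison argument: a discrete inequality over steps of length `T` gives the decay rate. -/
theorem le_psiInv_of_step (hc : 0 < c) (hmono : StrictMonoOn G (Ici 0))
    (h0 : G 0 = 0) (hbij : BijOn (hFun c G) (Ici 0) (Ici 0)) {E a : ℝ → ℝ} {T ν : ℝ}
    (hT : 0 < T) (hν : 0 ≤ ν) (ha : AntitoneOn a (Ici 0)) (ha0 : ∀ t ≥ 0, 0 ≤ a t)
    (hE : AntitoneOn E (Ici 0)) (hE0 : 0 < E 0)
    (hstep : ∀ t ≥ 0, T * (T * ν) * a (t + T) * pFun c G (E t) ≤ E t - E (t + T))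
    {t : ℝ} (ht : T ≤ t) :
    E t ≤ psiInv c G (E 0) (T * ν * ∫ s in T..t, a s) := by
  have hint : ∀ r ≥ 0, ∀ s ≥ 0, IntervalIntegrable a volume r s := fun r hr s hs =>
    (ha.mono fun q hq => (le_min hr hs).trans hq.1).intervalIntegrable
  have key : ∀ n : ℕ, 0 < E (n * T) →
      T * ν * (∫ s in T..((n : ℝ) + 1) * T, a s) ≤ psiFun c G (E 0) (E (n * T)) := by
    intro n
    induction n with
    | zero => intro _; simp [psiFun_self]
    | succ n ih =>
      intro hpos
      have hn : (0 : ℝ) ≤ n * T := by positivity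
      have hn1 : (0 : ℝ) ≤ ((n : ℝ) + 1) * T := by positivity
      have hn2 : (0 : ℝ) ≤ ((n : ℝ) + 1 + 1) * T := by positivity
      have hnn : n * T + T = ((n : ℝ) + 1) * T := by ring
      push_cast at hpos ⊢
      have hle : E (((n : ℝ) + 1) * T) ≤ E (n * T) := hE hn hn1 (by linarith)
      have hposn := hpos.trans_le hle
      have hp := pFun_pos h0 hbij hposn
      have h1 := div_pFun_le_psiFun_sub hc hmono h0 hbij hE0 hpos hle
      have h2 : T * (T * ν) * a (((n : ℝ) + 1) * T) ≤
          (E (n * T) - E (((n : ℝ) + 1) * T)) / pFun c G (E (n * T)) := by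
        rw [le_div_iff₀ hp, ← hnn]
        exact hstep _ hn
      -- The step controls `a` at the right end of its window, which dominates `a` only over the
      -- next window. This shift is why the integral starts at `T`.
      have h3 : (∫ s in ((n : ℝ) + 1) * T..((n : ℝ) + 1 + 1) * T, a s) ≤
          T * a (((n : ℝ) + 1) * T) := by
        have h4 := intervalIntegral.integral_mono_on
          (show ((n : ℝ) + 1) * T ≤ ((n : ℝ) + 1 + 1) * T by nlinarith) (hint _ hn1 _ hn2)
          (intervalIntegrable_const (c := a (((n : ℝ) + 1) * T)))
          (fun s hs => ha hn1 (hn1.trans hs.1) hs.1)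
        rw [intervalIntegral.integral_const, smul_eq_mul] at h4
        linarith
      have h5 := ih hposn
      have h6 := mul_le_mul_of_nonneg_left h3 (show 0 ≤ T * ν by positivity)
      rw [← intervalIntegral.integral_add_adjacent_intervals (hint T hT.le _ hn1)
        (hint _ hn1 _ hn2), mul_add]
      linarith
  refine le_psiInv hc hmono h0 hbij hE0 fun hpos => ?_
  have ht0 := hT.le.trans ht
  let n := ⌊t / T⌋₊
  have hn1 : (n : ℝ) * T ≤ t := by
    rw [← le_div_iff₀ hT]; exact Nat.floor_le (by positivity)
  have hn2 : t ≤ ((n : ℝ) + 1) * T := by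
    rw [← div_le_iff₀ hT]; exact (Nat.lt_floor_add_one _).le
  have hn : (0 : ℝ) ≤ n * T := by positivity
  have hEn : E t ≤ E (n * T) := hE hn ht0 hn1
  have h1 := key n (hpos.trans_le hEn)
  have h2 := (psiFun_strictAntiOn hc hmono h0 hbij hE0).antitoneOn hpos (hpos.trans_le hEn) hEn
  have h3 : (∫ s in T..t, a s) ≤ ∫ s in T..((n : ℝ) + 1) * T, a s := by
    rw [← intervalIntegral.integral_add_adjacent_intervals (hint T hT.le t ht0)
      (hint t ht0 _ (ht0.trans hn2))]
    exact le_add_of_nonneg_right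
      (intervalIntegral.integral_nonneg hn2 fun s hs => ha0 s (ht0.trans hs.1))
  have h4 := mul_le_mul_of_nonneg_left h3 (show 0 ≤ T * ν by positivity)
  linarith

end InverseFunctions

/-! ### Pointwise inequalities for the nonlinearity. -/

section Pointwise

variable {E : Type*} [NormedAddCommGroup E] [InnerProductSpace ℝ E]

/-- The right side minus the left is exactly `‖b‖² + ‖a - b + α • γ‖²`. -/
theorem two_mul_inner_sub_le (α : ℝ) (a b γ : E) :
    2 * (-(α * ⟪γ, a - b⟫) + ⟪b, a - b⟫) ≤ ‖a‖ ^ 2 + α ^ 2 * ‖γ‖ ^ 2 := by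
  have h1 : 0 ≤ ‖a - b + α • γ‖ ^ 2 := by positivity
  have h2 : 0 ≤ ‖b‖ ^ 2 := by positivity
  simp only [← real_inner_self_eq_norm_sq, inner_add_left, inner_add_right, inner_sub_left,
    inner_sub_right, real_inner_smul_left, real_inner_smul_right, real_inner_comm a b,
    real_inner_comm a γ, real_inner_comm b γ] at h1 h2 ⊢
  nlinarith

/-- For `‖x‖ ≥ 1`, growth gives `‖g x‖ ≤ 2M‖x‖` and coercivity absorbs everything; for `‖x‖ ≤ 1`,
`G` is replaced by its affine majorant at `q`. -/
theorem norm_sq_add_norm_sq_le {g : E → E} {G : ℝ → ℝ} {M m q : ℝ} (hm : 0 < m) (hM : 0 < M)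
    (hgrowth : ∀ x, ‖g x‖ ≤ M * (1 + ‖x‖)) (hcoer : ∀ x, 1 ≤ ‖x‖ → m * ‖x‖ ^ 2 ≤ ⟪g x, x⟫)
    (hconc : ConcaveOn ℝ (Ici 0) G) (hmono : StrictMonoOn G (Ici 0)) (h0 : G 0 = 0)
    (hzero : ∀ x, ‖x‖ ≤ 1 → ‖x‖ ^ 2 + ‖g x‖ ^ 2 ≤ G ⟪g x, x⟫)
    (hpos : ∀ x, 0 ≤ ⟪g x, x⟫) (hq : 0 < q) (x : E) :
    ‖x‖ ^ 2 + ‖g x‖ ^ 2 ≤ ((1 + 4 * M ^ 2) / m + G q / q) * ⟪g x, x⟫ + G q := by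
  have hGq := nonneg_of_strictMonoOn_zero hmono h0 hq.le
  have hp := hpos x
  rw [add_mul]
  rcases le_total ‖x‖ 1 with h | h
  · have h1 := hzero x h
    have h2 := hconc.le_add_div_mul hmono h0 hq hp
    have : 0 ≤ (1 + 4 * M ^ 2) / m * ⟪g x, x⟫ := by positivity
    linarith
  · have h1 := hgrowth x
    have h2 : ‖g x‖ ≤ 2 * M * ‖x‖ := by nlinarith
    have h3 : ‖g x‖ ^ 2 ≤ (2 * M * ‖x‖) ^ 2 := by gcongr
    have h4 : ‖x‖ ^ 2 ≤ ⟪g x, x⟫ / m := by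
      rw [le_div_iff₀ hm, mul_comm]; exact hcoer x h
    have h5 : ‖x‖ ^ 2 + ‖g x‖ ^ 2 ≤ (1 + 4 * M ^ 2) / m * ⟪g x, x⟫ := by
      calc _ ≤ (1 + 4 * M ^ 2) * ‖x‖ ^ 2 := by linarith
        _ ≤ (1 + 4 * M ^ 2) * (⟪g x, x⟫ / m) := by gcongr
        _ = _ := by ring
    have : 0 ≤ G q / q * ⟪g x, x⟫ := by positivity
    linarith

end Pointwise

/-! ### Coefficients, feedback and energy of the system. -/

namespace HyperbolicSystem

variable {J : ℕ} {N : Fin J → ℕ}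
  {X : Fin J → Type u} [∀ j, MetricSpace (X j)] [∀ j, MeasurableSpace (X j)]
  [∀ j, OpensMeasurableSpace (X j)]
  {𝓗 : Type v} [NormedAddCommGroup 𝓗] [InnerProductSpace ℝ 𝓗]
  {𝓥 : Type w} [NormedAddCommGroup 𝓥] [InnerProductSpace ℝ 𝓥]
  (Y : HyperbolicSystem J N X 𝓗 𝓥)

theorem inner_g_self_nonneg (j : Fin J) (x : EuclideanSpace ℝ (Fin (N j))) :
    0 ≤ ⟪Y.g j x, x⟫ := by
  simpa [Y.g_zero] using Y.g_monotone j x 0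

theorem alpha_le (hanti : ∀ j x, AntitoneOn (fun t => Y.α j t x) (Ici 0))
    (hbdd : ∀ j, BddAbove (range (Y.α j 0))) {t : ℝ} (ht : 0 ≤ t) (j : Fin J) (x : X j) :
    Y.α j t x ≤ Y.alphaSup :=
  (hanti j x self_mem_Ici ht ht).trans <| (le_ciSup (hbdd j) x).trans <|
    le_ciSup (f := fun j => ⨆ x, Y.α j 0 x) (Finite.bddAbove_range _) j

theorem bddBelow_alpha {t : ℝ} (ht : 0 ≤ t) (j : Fin J) : BddBelow (range (Y.α j t)) :=
  ⟨0, by rintro _ ⟨x, rfl⟩; exact (Y.α_pos j t ht x).le⟩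

theorem alphaInf_le {t : ℝ} (ht : 0 ≤ t) (j : Fin J) (x : X j) : Y.alphaInf t ≤ Y.α j t x :=
  (ciInf_le (f := fun j => ⨅ x, Y.α j t x) (Finite.bddBelow_range _) j).trans
    (ciInf_le (Y.bddBelow_alpha ht j) x)

theorem alphaInf_antitoneOn [∀ j, Nonempty (X j)]
    (hanti : ∀ j x, AntitoneOn (fun t => Y.α j t x) (Ici 0)) :
    AntitoneOn Y.alphaInf (Ici 0) := fun _ hs _ ht hst =>
  ciInf_mono (Finite.bddBelow_range _) fun j =>
    ciInf_mono (Y.bddBelow_alpha ht j) fun x => hanti j x hs ht hst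

theorem maxMass_nonneg : 0 ≤ Y.maxMass := Real.iSup_nonneg fun _ => measureReal_nonneg

theorem minMass_nonneg : 0 ≤ Y.minMass := Real.iInf_nonneg fun _ => measureReal_nonneg

theorem mass_le_maxMass (j : Fin J) : (Y.μ j).real univ ≤ Y.maxMass :=
  le_ciSup (f := fun j => (Y.μ j).real univ) (Finite.bddAbove_range _) j

theorem minMass_le_maxMass (hJ : 1 ≤ J) : Y.minMass ≤ Y.maxMass :=
  (ciInf_le (f := fun j => (Y.μ j).real univ) (Finite.bddBelow_range _) ⟨0, hJ⟩).trans
    (Y.mass_le_maxMass _)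

theorem comp_sub (u v : 𝓥) (j : Fin J) : Y.comp (u - v) j = Y.comp u j - Y.comp v j := by
  have h : Y.IU (u - v) = Y.IU u - Y.IU v := LinearMap.map_sub Y.IU.toLinearMap u v
  rw [comp, h]
  rfl

theorem inner_IU (u v : 𝓥) :
    ⟪Y.IU u, Y.IU v⟫ = ∑ j, ∫ x, ⟪Y.comp u j x, Y.comp v j x⟫ ∂(Y.μ j) := by
  rw [PiLp.inner_apply]
  exact Finset.sum_congr rfl fun j _ => L2.inner_def _ _

theorem integrable_feedback {M a t : ℝ} (hgrowth : ∀ j x, ‖Y.g j x‖ ≤ M * (1 + ‖x‖))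
    (ht : 0 ≤ t) (ha : ∀ j x, Y.α j t x ≤ a) (u v : 𝓥) (j : Fin J) :
    Integrable (fun x => Y.α j t x * ⟪Y.g j (Y.comp u j x), Y.comp v j x⟫) (Y.μ j) := by
  have := Y.μ_finite j
  have hα : Continuous (Y.α j t) :=
    (Y.α_continuous j).comp_continuous (f := fun x => (t, x)) (by fun_prop)
      fun x => ⟨ht, mem_univ _⟩
  have hg : MemLp (fun x => Y.g j (Y.comp u j x)) 2 (Y.μ j) := by
    refine MemLp.of_le_mul (c := M) (g := fun x => 1 + ‖Y.comp u j x‖)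
      ((memLp_const (1 : ℝ)).add (Lp.memLp _).norm)
      ((Y.g_continuous j).comp_aestronglyMeasurable (Lp.aestronglyMeasurable _))
      (Eventually.of_forall fun x => ?_)
    rw [Real.norm_of_nonneg (by positivity : 0 ≤ 1 + ‖Y.comp u j x‖)]
    exact hgrowth j _
  have hi : Integrable (fun x => ⟪Y.g j (Y.comp u j x), Y.comp v j x⟫) (Y.μ j) :=
    (L2.integrable_inner (𝕜 := ℝ) (hg.toLp _) (Y.comp v j)).congr <| by
      filter_upwards [hg.coeFn_toLp] with x hx
      rw [hx]
  refine hi.bdd_mul (c := a) hα.measurable.aestronglyMeasurable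
    (Eventually.of_forall fun x => ?_)
  rw [Real.norm_of_nonneg (Y.α_pos j t ht x).le]
  exact ha j x

theorem B_self_nonneg {t : ℝ} (ht : 0 ≤ t) (u : 𝓥) : 0 ≤ Y.B t u u :=
  Finset.sum_nonneg fun j _ => integral_nonneg fun x =>
    mul_nonneg (Y.α_pos j t ht x).le (Y.inner_g_self_nonneg j _)

/-- The pointwise inequalities are integrated; the lower bound `β` on the coefficients turns `g(ξ) ·
ξ` into the density of `B`, and the constant term picks up the total mass. -/
theorem feedback_le {M m q β t : ℝ} {G : ℝ → ℝ} (hm : 0 < m) (hM : 0 < M)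
    (hgrowth : ∀ j x, ‖Y.g j x‖ ≤ M * (1 + ‖x‖))
    (hcoer : ∀ j x, 1 ≤ ‖x‖ → m * ‖x‖ ^ 2 ≤ ⟪Y.g j x, x⟫)
    (hconc : ConcaveOn ℝ (Ici 0) G) (hmono : StrictMonoOn G (Ici 0)) (h0 : G 0 = 0)
    (hzero : ∀ j x, ‖x‖ ≤ 1 → ‖x‖ ^ 2 + ‖Y.g j x‖ ^ 2 ≤ G ⟪Y.g j x, x⟫)
    (hanti : ∀ j x, AntitoneOn (fun t => Y.α j t x) (Ici 0))
    (hbdd : ∀ j, BddAbove (range (Y.α j 0)))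
    (hq : 0 < q) (hβ : 0 < β) (ht : 0 ≤ t) (hβα : ∀ j x, β ≤ Y.α j t x) (u v : 𝓥) :
    2 * (-Y.B t u (u - v) + ⟪Y.IU v, Y.IU (u - v)⟫) ≤
      (1 + Y.alphaSup ^ 2) * ((1 + 4 * M ^ 2) / m + G q / q) / β * Y.B t u u +
        (1 + Y.alphaSup ^ 2) * G q * (J * Y.maxMass) := by
  have hGq := nonneg_of_strictMonoOn_zero hmono h0 hq.le
  set κ := (1 + 4 * M ^ 2) / m + G q / q with hκ
  have hκ0 : 0 ≤ κ := by positivity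
  have hint := fun u v j => Y.integrable_feedback hgrowth ht (Y.alpha_le hanti hbdd ht) u v j
  have hmass : ∑ j, (1 + Y.alphaSup ^ 2) * G q * (Y.μ j).real univ ≤
      (1 + Y.alphaSup ^ 2) * G q * (J * Y.maxMass) := by
    rw [← Finset.mul_sum]
    refine mul_le_mul_of_nonneg_left ?_ (by positivity)
    simpa using Finset.sum_le_card_nsmul Finset.univ (fun j => (Y.μ j).real univ) _
      fun j _ => Y.mass_le_maxMass j
  refine le_trans ?_ (add_le_add_right hmass _)
  rw [inner_IU, B, B, ← Finset.sum_neg_distrib, ← Finset.sum_add_distrib, Finset.mul_sum,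
    Finset.mul_sum, ← Finset.sum_add_distrib]
  refine Finset.sum_le_sum fun j _ => ?_
  have := Y.μ_finite j
  have hI : Integrable (fun x => ⟪Y.comp v j x, Y.comp (u - v) j x⟫) (Y.μ j) :=
    L2.integrable_inner _ _
  have e3 : (1 + Y.alphaSup ^ 2) * G q * (Y.μ j).real univ =
      ∫ _, (1 + Y.alphaSup ^ 2) * G q ∂(Y.μ j) := by
    rw [integral_const, smul_eq_mul, mul_comm]
  have e1 := integral_add (hint u (u - v) j).neg hI
  simp only [Pi.neg_apply] at e1
  rw [← integral_neg, ← e1, ← integral_const_mul,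
    ← integral_const_mul, e3, ← integral_add ((hint _ _ j).const_mul _) (integrable_const _)]
  refine integral_mono_ae (((hint _ _ j).neg.add hI).const_mul _)
    (((hint _ _ j).const_mul _).add (integrable_const _)) ?_
  rw [comp_sub]
  filter_upwards [Lp.coeFn_sub (Y.comp u j) (Y.comp v j)] with x hx
  simp only [hx, Pi.sub_apply]
  set a := Y.comp u j x
  have hp := Y.inner_g_self_nonneg j a
  have hα0 := Y.α_pos j t ht x
  have hαs := Y.alpha_le hanti hbdd ht j x
  have h1 := two_mul_inner_sub_le (Y.α j t x) a (Y.comp v j x) (Y.g j a)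
  have h2 := norm_sq_add_norm_sq_le hm hM (hgrowth j) (hcoer j) hconc hmono h0 (hzero j)
    (Y.inner_g_self_nonneg j) hq a
  have hsq : Y.α j t x ^ 2 ≤ Y.alphaSup ^ 2 := by gcongr
  have h3 : ‖a‖ ^ 2 + Y.α j t x ^ 2 * ‖Y.g j a‖ ^ 2 ≤
      (1 + Y.alphaSup ^ 2) * (‖a‖ ^ 2 + ‖Y.g j a‖ ^ 2) := by
    have := mul_le_mul_of_nonneg_right hsq (sq_nonneg ‖Y.g j a‖)
    nlinarith [mul_nonneg (sq_nonneg Y.alphaSup) (sq_nonneg ‖a‖), sq_nonneg ‖Y.g j a‖]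
  have h4 : κ * ⟪Y.g j a, a⟫ ≤ κ / β * (Y.α j t x * ⟪Y.g j a, a⟫) := by
    rw [div_mul_eq_mul_div, le_div_iff₀ hβ]
    have := mul_le_mul_of_nonneg_right (hβα j x) (mul_nonneg hκ0 hp)
    linarith
  calc _ ≤ _ := h1
    _ ≤ _ := h3
    _ ≤ (1 + Y.alphaSup ^ 2) * (κ / β * (Y.α j t x * ⟪Y.g j a, a⟫) + G q) :=
      mul_le_mul_of_nonneg_left (by linarith) (by positivity)
    _ = _ := by ring

/-! ### Energy of a solution over a time window. -/

section Solution

variable {Y} {x : ℝ → 𝓗}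

theorem IsSolution.energy_antitoneOn (hx : Y.IsSolution x) : AntitoneOn (energy x) (Ici 0) := by
  obtain ⟨hcont, y, hy, Z, hZ, hd⟩ := hx
  intro a ha b hb hab
  have ha : 0 ≤ a := ha
  refine le_of_rightDeriv_nonpos_off_countable (f' := fun t => 2 * ⟪x t, -y t⟫ / 2) hab
    (((hcont.mono fun t ht => ha.trans ht.1).norm.pow 2).div_const 2) hZ
    (fun t ht htZ => ((hd t (ha.trans ht.1) htZ).1.mono
      (Ici_subset_Ici.2 (ha.trans ht.1))).norm_sq.div_const 2) fun t ht _ => ?_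
  obtain ⟨u, hu, huy⟩ := hy t (ha.trans ht.1)
  have := Y.B_self_nonneg (ha.trans ht.1) u
  have h2 : Y.A₁ u u + Y.B t u u = ⟪y t, Y.ι u⟫ := huy u
  rw [Y.A₁_skew, hu, real_inner_comm] at h2
  rw [inner_neg_right]
  linarith

/-- Comparison of a solution with an orbit of the stable linear semigroup on a time window. -/
theorem IsSolution.norm_sub_orbit_sq_le (hx : Y.IsSolution x) {S : ℝ → 𝓗 →L[ℝ] 𝓗}
    (hS : IsContractionSemigroup S) (hgen : IsGeneratorGraph S Y.graphBackward)
    {a T Λ K : ℝ} (ha : 0 ≤ a) (hT : 0 ≤ T)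
    (hfeed : ∀ t ∈ Icc a (a + T), ∀ u v,
      2 * (-Y.B t u (u - v) + ⟪Y.IU v, Y.IU (u - v)⟫) ≤ Λ * Y.B t u u + K)
    {z z' : 𝓗} (hz : Y.graphBackward z z') :
    ‖x (a + T) - S T z‖ ^ 2 ≤
      ‖x a - z‖ ^ 2 + Λ * (energy x a - energy x (a + T)) + K * T := by
  obtain ⟨hcont, y, hy, Z, hZ, hd⟩ := hx
  have hlim := (hgen z z').1 hz
  -- `B(t)(u, u)` is minus the derivative of the energy, so adding `Λ * energy` and subtracting `K *
  -- t` makes the squared distance non-increasing.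
  have h := le_of_rightDeriv_nonpos_off_countable
    (f := fun t => ‖x t - S (t - a) z‖ ^ 2 + Λ * energy x t - K * t)
    (f' := fun t => 2 * ⟪x t - S (t - a) z, -y t - S (t - a) z'⟫ +
      Λ * (2 * ⟪x t, -y t⟫ / 2) - K * 1)
    (show a ≤ a + T by linarith) ?_ hZ ?_ ?_
  · simp only [add_sub_cancel_left, sub_self, hS.zero, ContinuousLinearMap.id_apply] at h
    linarith
  · have hx' : ContinuousOn x (Icc a (a + T)) := hcont.mono fun t ht => ha.trans ht.1
    have hz' : ContinuousOn (fun t => S (t - a) z) (Icc a (a + T)) :=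
      (hS.continuousOn z).comp (by fun_prop) fun t ht => sub_nonneg.2 ht.1
    exact (((hx'.sub hz').norm.pow 2).add
      (((hx'.norm.pow 2).div_const 2).const_mul Λ)).sub (by fun_prop)
  · intro t ht htZ
    have hx' := (hd t (ha.trans ht.1) htZ).1.mono (Ici_subset_Ici.2 (ha.trans ht.1))
    exact ((hx'.sub (hS.hasDerivWithinAt_orbit hlim ht.1)).norm_sq.add
      ((hx'.norm_sq.div_const 2).const_mul Λ)).sub ((hasDerivWithinAt_id t _).const_mul K)
  · intro t ht _
    obtain ⟨u, hu, huy⟩ := hy t (ha.trans ht.1)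
    obtain ⟨v, hv, hvz⟩ := (hgen _ _).2 (hS.tendsto_orbit hlim (sub_nonneg.2 ht.1))
    have h1 := hfeed t ⟨ht.1, ht.2.le⟩ u v
    have h2 : Y.A₁ u u + Y.B t u u = ⟪y t, Y.ι u⟫ := huy u
    have h3 : Y.A₁ u (u - v) + Y.B t u (u - v) = ⟪y t, Y.ι (u - v)⟫ := huy (u - v)
    have h4 : -Y.A₁ v (u - v) - ⟪Y.IU v, Y.IU (u - v)⟫ = ⟪S (t - a) z', Y.ι (u - v)⟫ :=
      hvz (u - v)
    -- Removes `A₁` from the difference of the two weak equations tested with `u - v`.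
    have h5 := Y.A₁_skew (u - v)
    rw [Y.A₁_skew, hu, real_inner_comm] at h2
    rw [map_sub Y.ι, hu, hv] at h3 h4
    rw [real_inner_comm] at h3
    rw [real_inner_comm (x t - S (t - a) z) (S (t - a) z')] at h4
    rw [map_sub Y.A₁, sub_apply] at h5
    rw [inner_sub_right, inner_neg_right, inner_neg_right]
    have h6 : ⟪x t, y t⟫ = Y.B t u u := by linarith
    rw [h6]
    linarith

/-- The comparison needs a starting point in the generator's domain; density and continuity extend
it to `x a`. The factor `1 / 2` then lets half of the initial energy be absorbed on the left. -/
theorem IsSolution.energy_le [CompleteSpace 𝓗] (hx : Y.IsSolution x) {C ω : ℝ}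
    (hexp : Y.ExpStable C ω) {a T Λ K : ℝ} (ha : 0 ≤ a) (hT : 0 ≤ T)
    (hCT : C * Real.exp (-ω * T) ≤ 1 / 2)
    (hfeed : ∀ t ∈ Icc a (a + T), ∀ u v,
      2 * (-Y.B t u (u - v) + ⟪Y.IU v, Y.IU (u - v)⟫) ≤ Λ * Y.B t u u + K) :
    energy x a ≤ 2 * (Λ * (energy x a - energy x (a + T)) + K * T) +
      2 * (energy x a - energy x (a + T)) := by
  obtain ⟨-, S, hS, hgen, hdecay⟩ := hexp
  have key : ‖x (a + T) - S T (x a)‖ ^ 2 ≤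
      Λ * (energy x a - energy x (a + T)) + K * T := by
    have hcl : IsClosed {z | ‖x (a + T) - S T z‖ ^ 2 ≤
        ‖x a - z‖ ^ 2 + Λ * (energy x a - energy x (a + T)) + K * T} :=
      isClosed_le (by fun_prop) (by fun_prop)
    have hmem : x a ∈ closure {z | ‖x (a + T) - S T z‖ ^ 2 ≤
        ‖x a - z‖ ^ 2 + Λ * (energy x a - energy x (a + T)) + K * T} :=
      Metric.mem_closure_iff.2 fun ε hε => by
        obtain ⟨z, z', hz, hzx⟩ := hS.exists_tendsto_norm_sub_lt (x a) hε
        exact ⟨z, hx.norm_sub_orbit_sq_le hS hgen ha hT hfeed ((hgen z z').2 hz),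
          by rwa [dist_comm, dist_eq_norm]⟩
    rw [hcl.closure_eq] at hmem
    simpa using hmem
  have h1 : ‖S T (x a)‖ ≤ 1 / 2 * ‖x a‖ :=
    (hdecay T hT _).trans (mul_le_mul_of_nonneg_right hCT (norm_nonneg _))
  have h2 : ‖x (a + T)‖ ≤ ‖x (a + T) - S T (x a)‖ + 1 / 2 * ‖x a‖ := by
    have := norm_le_norm_sub_add (x (a + T)) (S T (x a))
    linarith
  have h3 : ‖x (a + T)‖ ^ 2 ≤ (‖x (a + T) - S T (x a)‖ + 1 / 2 * ‖x a‖) ^ 2 := by gcongr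
  have h4 := sq_nonneg (‖x (a + T) - S T (x a)‖ - 1 / 2 * ‖x a‖)
  simp only [energy] at key ⊢
  nlinarith

end Solution

end HyperbolicSystem

/-! ### The constant, the one-step inequality and the conclusion. -/

/-- The constant in the decay estimate. -/
noncomputable def decayConstant (T : ℝ) (J : ℕ) (μmax αsup M m : ℝ) : ℝ :=
  1 + 2 * (1 + αsup ^ 2) * ((1 + 4 * M ^ 2) / m + 1) * T ^ 2 * |μmax| +
    2 * (1 + αsup ^ 2) * J * |μmax| * T + 2 * |αsup| * T ^ 2 * |μmax|

theorem decayConstant_pos {T : ℝ} (hT : 0 < T) (J : ℕ) (μmax αsup M : ℝ) {m : ℝ} (hm : 0 < m) :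
    0 < decayConstant T J μmax αsup M m := by
  unfold decayConstant; positivity

theorem HyperbolicSystem.IsSolution.step_le {J : ℕ} (hJ : 1 ≤ J) {N : Fin J → ℕ}
    {X : Fin J → Type u} [∀ j, MetricSpace (X j)] [∀ j, MeasurableSpace (X j)]
    [∀ j, OpensMeasurableSpace (X j)] [∀ j, Nonempty (X j)]
    {𝓗 : Type v} [NormedAddCommGroup 𝓗] [InnerProductSpace ℝ 𝓗] [CompleteSpace 𝓗]
    {𝓥 : Type w} [NormedAddCommGroup 𝓥] [InnerProductSpace ℝ 𝓥]
    {Y : HyperbolicSystem J N X 𝓗 𝓥} {x : ℝ → 𝓗} (hx : Y.IsSolution x)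
    {C ω T M m : ℝ} {G : ℝ → ℝ} (hexp : Y.ExpStable C ω) (hT : 0 < T)
    (hCT : C * Real.exp (-ω * T) ≤ 1 / 2) (hm : 0 < m) (hM : 0 < M)
    (hgrowth : ∀ j x, ‖Y.g j x‖ ≤ M * (1 + ‖x‖))
    (hcoer : ∀ j x, 1 ≤ ‖x‖ → m * ‖x‖ ^ 2 ≤ ⟪Y.g j x, x⟫)
    (hconc : ConcaveOn ℝ (Ici 0) G) (hmono : StrictMonoOn G (Ici 0)) (h0 : G 0 = 0)
    (hzero : ∀ j x, ‖x‖ ≤ 1 → ‖x‖ ^ 2 + ‖Y.g j x‖ ^ 2 ≤ G ⟪Y.g j x, x⟫)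
    (hanti : ∀ j x, AntitoneOn (fun t => Y.α j t x) (Ici 0))
    (hbdd : ∀ j, BddAbove (range (Y.α j 0))) (hinf : ∀ t ≥ 0, 0 < Y.alphaInf t)
    (hbij : BijOn (hFun (decayConstant T J Y.maxMass Y.alphaSup M m) G) (Ici 0) (Ici 0))
    {a : ℝ} (ha : 0 ≤ a) :
    T * (T * Y.minMass) * Y.alphaInf (a + T) *
        pFun (decayConstant T J Y.maxMass Y.alphaSup M m) G (energy x a) ≤
      energy x a - energy x (a + T) := by
  have haT : 0 ≤ a + T := by positivity
  have hβ := hinf (a + T) haT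
  set β := Y.alphaInf (a + T)
  have hΔ : 0 ≤ energy x a - energy x (a + T) :=
    sub_nonneg.2 (hx.energy_antitoneOn ha haT (by linarith))
  have hEa : 0 ≤ energy x a := by unfold energy; positivity
  -- Some `X j` may have measure zero; the claim is then just monotonicity of the energy, and the
  -- division below would fail.
  rcases eq_or_lt_of_le Y.minMass_nonneg with hν | hν
  · rw [← hν]; simpa using hΔ
  have hμ := Y.minMass_le_maxMass hJ
  have hμ0 := Y.maxMass_nonneg
  have hβs : β ≤ Y.alphaSup :=
    (Y.alphaInf_le haT ⟨0, hJ⟩ (Classical.arbitrary _)).trans (Y.alpha_le hanti hbdd haT _ _)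
  have hd : 0 < T * (T * Y.minMass) * β := by positivity
  rw [← le_div_iff₀' hd]
  -- The quotient itself may be zero, whereas the affine bound on `G` needs `q > 0`; hence all
  -- larger `q` are used.
  refine le_of_forall_gt_imp_ge_of_dense fun q hq => ?_
  have hq0 : 0 < q := (div_nonneg hΔ hd.le).trans_lt hq
  rw [div_lt_iff₀ hd] at hq
  have hGq := nonneg_of_strictMonoOn_zero hmono h0 hq0.le
  rw [pFun_le_iff (decayConstant_pos hT J _ _ _ hm) hmono hbij hEa hq0.le]
  -- As the coefficients decrease in time, their infimum at `a + T` bounds them below on the whole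
  -- window.
  have hE := hx.energy_le hexp ha hT.le hCT fun t ht u v =>
    Y.feedback_le hm hM hgrowth hcoer hconc hmono h0 hzero hanti hbdd hq0 hβ (ha.trans ht.1)
      (fun j x => (Y.alphaInf_le haT j x).trans (hanti j x (ha.trans ht.1) haT ht.2)) u v
  refine hE.trans ?_
  set Δ := energy x a - energy x (a + T)
  set A := 1 + Y.alphaSup ^ 2 with hA
  set κ := (1 + 4 * M ^ 2) / m with hκ
  have hA0 : 0 < A := by positivity
  have hκ0 : 0 < κ := by positivity
  have hΔ1 : Δ ≤ q * T ^ 2 * Y.maxMass * β := by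
    calc Δ ≤ q * T ^ 2 * Y.minMass * β := by linarith
      _ ≤ _ := by gcongr
  have hΔ2 : Δ ≤ q * T ^ 2 * Y.maxMass * Y.alphaSup := hΔ1.trans (by gcongr)
  have h1 : A * (κ + G q / q) / β * Δ ≤ A * (κ * q + G q) * T ^ 2 * Y.maxMass := by
    calc _ ≤ A * (κ + G q / q) / β * (q * T ^ 2 * Y.maxMass * β) := by gcongr
      _ = _ := by field_simp
  have hs0 : 0 ≤ Y.alphaSup := hβ.le.trans hβs
  have hr1 : 0 ≤ A * q * T ^ 2 * Y.maxMass := by positivity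
  have hr2 : 0 ≤ A * κ * G q * T ^ 2 * Y.maxMass := by positivity
  have hr3 : 0 ≤ A * J * Y.maxMass * T * q := by positivity
  have hr4 : 0 ≤ Y.alphaSup * T ^ 2 * Y.maxMass * G q := by positivity
  -- The last three summands of the constant absorb the `Λ`, `K` and `2Δ` terms respectively. The
  -- `1` and the absolute values keep it positive for arbitrary real parameters, since it is chosen
  -- before the system.
  rw [hFun, decayConstant, abs_of_nonneg hμ0, abs_of_nonneg hs0, ← hA, ← hκ]
  linarith

theorem mainTheorem1 (C ω : ℝ) (hC : 0 < C) (hω : 0 < ω) :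
    ∃ T₀ > 0, ∀ T ≥ T₀, ∀ J : ℕ, 1 ≤ J → ∀ μmax αsup M m : ℝ, 0 < M → 0 < m →
    ∃ c > 0, ∀ (N : Fin J → ℕ)
      (X : Fin J → Type u) [∀ j, MetricSpace (X j)] [∀ j, MeasurableSpace (X j)]
      [∀ j, OpensMeasurableSpace (X j)] [∀ j, Nonempty (X j)]
      (𝓗 : Type v) [NormedAddCommGroup 𝓗] [InnerProductSpace ℝ 𝓗] [CompleteSpace 𝓗]
      (𝓥 : Type w) [NormedAddCommGroup 𝓥] [InnerProductSpace ℝ 𝓥] [CompleteSpace 𝓥]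
      (Y : HyperbolicSystem J N X 𝓗 𝓥) (G : ℝ → ℝ),
      Y.ExpStable C ω →
      Y.maxMass = μmax →
      -- growth, coercivity at infinity, and behaviour near zero of the nonlinearities
      (∀ j x, ‖Y.g j x‖ ≤ M * (1 + ‖x‖)) →
      (∀ j x, 1 ≤ ‖x‖ → m * ‖x‖ ^ 2 ≤ ⟪Y.g j x, x⟫) →
      ConcaveOn ℝ (Ici 0) G → StrictMonoOn G (Ici 0) → G 0 = 0 →
      ContinuousWithinAt G (Ici 0) 0 →
      (∀ j x, ‖x‖ ≤ 1 → ‖x‖ ^ 2 + ‖Y.g j x‖ ^ 2 ≤ G ⟪Y.g j x, x⟫) →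
      -- the coefficients are non-increasing in time, bounded above at time 0,
      -- and bounded below by a positive constant at each time
      (∀ j x, AntitoneOn (fun t => Y.α j t x) (Ici 0)) →
      (∀ j, BddAbove (range (Y.α j 0))) → Y.alphaSup = αsup →
      (∀ t ≥ 0, 0 < Y.alphaInf t) →
      BijOn (hFun c G) (Ici 0) (Ici 0) ∧
      ∀ x : ℝ → 𝓗, Y.IsSolution x →
        (energy x 0 = 0 → ∀ t ≥ 0, energy x t = 0) ∧
        (0 < energy x 0 →
          (∀ r > 0, IntervalIntegrable (fun s => 1 / pFun c G s) volume r (energy x 0)) ∧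
          BijOn (psiFun c G (energy x 0)) (Ioi 0) univ ∧
          ∀ t ≥ T, IntervalIntegrable Y.alphaInf volume T t ∧
            energy x t ≤
              psiInv c G (energy x 0) (T * Y.minMass * ∫ s in T..t, Y.alphaInf s)) := by
  have hT0 : 0 < 2 * C / ω := by positivity
  -- With this threshold `exp (ω * T) ≥ ω * T + 1 ≥ 2 * C`, so the semigroup has norm at most `1 /
  -- 2` at time `T`.
  refine ⟨2 * C / ω, hT0, fun T hT J hJ μmax αsup M m hM hm => ?_⟩
  have hTpos : 0 < T := hT0.trans_le hT
  refine ⟨decayConstant T J μmax αsup M m, decayConstant_pos hTpos J _ _ _ hm, ?_⟩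
  rintro N X _ _ _ _ 𝓗 _ _ _ 𝓥 _ _ _ Y G hexp rfl hgrowth hcoer hconc hmono h0 hcont hzero hanti
    hbdd rfl hinf
  have hc := decayConstant_pos hTpos J Y.maxMass Y.alphaSup M hm
  have hbij := hFun_bijOn hc hconc hmono h0 hcont
  have hCT : C * Real.exp (-ω * T) ≤ 1 / 2 := by
    have h1 : 2 * C ≤ ω * T := by rw [mul_comm ω]; exact (div_le_iff₀ hω).1 hT
    have h2 := Real.add_one_le_exp (ω * T)
    rw [neg_mul, Real.exp_neg, ← div_eq_mul_inv, div_le_iff₀ (Real.exp_pos _)]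
    linarith
  refine ⟨hbij, fun x hx => ⟨fun hE t ht => ?_, fun hE => ⟨fun r hr =>
    intervalIntegrable_one_div_pFun hc hmono h0 hbij hr hE, psiFun_bijOn hc hmono h0 hbij hE,
    fun t ht => ⟨?_, ?_⟩⟩⟩⟩
  · refine le_antisymm ((hx.energy_antitoneOn self_mem_Ici ht ht).trans_eq hE) ?_
    unfold energy; positivity
  · exact ((Y.alphaInf_antitoneOn hanti).mono fun s hs =>
      (le_min hTpos.le (hTpos.le.trans ht)).trans hs.1).intervalIntegrable
  · exact le_psiInv_of_step hc hmono h0 hbij hTpos Y.minMass_nonneg (Y.alphaInf_antitoneOn hanti)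
      (fun s hs => (hinf s hs).le) hx.energy_antitoneOn hE
      (fun a ha => hx.step_le hJ hexp hTpos hCT hm hM hgrowth hcoer hconc hmono h0 hzero hanti
        hbdd hinf hbij ha) ht
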